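/- A topological group $G$ is called simply $sm$-factorizable if for every co-zero set $U$ in $G$ there is a continuous homomorphism $\pi$ of $G$ onto a separable metrizable topological group $H$ with $\pi^{-1}(\pi(U))=U$. For a Hausdorff topological group $G$, let $\mu G$ be the Dieudonné completion of $G$ (the completion with respect to the finest uniformity compatible with the topology of $G$), let $\upsilon G$ be the Hewitt–Nachbin realcompactification of $G$ (the closure of the canonical image of $G$ in $\mathbb{R}^{C(G)}$, where $C(G)$ is the set of continuous functions $G\to\mathbb{R}$), let $\varrho G$ be the Raĭkov completion of $G$ (the completion with respect to the two-sided uniformity), and let $\varrho_\omega G$ be the $G_\delta$-closure of $G$ in $\varrho G$, that is, the set of all $x\in\varrho G$ such that every $G_\delta$-set of $\varrho G$ containing $x$ meets $G$. Theorem. Let $G$ be a Hausdorff simply $sm$-factorizable topological group. Then $\mu G=\varrho_\omega G=\upsilon G$, in the sense that there are homeomorphisms $\mu G\to\varrho_\omega G$ and $\varrho_\omega G\to\upsilon G$ compatible with the canonical maps of $G$ into these spaces. Consequently, $G$ is completion friendly: the canonical map $G\to\varrho_\omega G$ is a topological embedding and every continuous function $f\colon G\to\mathbb{R}$ extends to a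 continuous function $\varrho_\omega G\to\mathbb{R}$. Moreover, $G$ is a $PT$-group: the multiplication and the inversion of $G$ extend to continuous maps $\mu G\times\mu G\to\mu G$ and $\mu G\to\mu G$. -/

import Mathlib

namespace SMFactor

open Set

universe u

/-- A co-zero set of `X`: the complement of the zero set of a continuous real-valued function. -/
def IsCozero {X : Type u} [TopologicalSpace X] (U : Set X) : Prop :=
  ∃ f : X → ℝ, Continuous f ∧ U = {x | f x ≠ 0}

/-- A topological group `G` is simply `sm`-factorizable if for every co-zero set `U` of `G` there is
a continuous homomorphism `π` of `G` onto a separable metrizable topological group `H` with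
`π ⁻¹ (π U) = U`. (As `H` is an image of `G`, taking `H` in the universe of `G` is no loss.) -/
def IsSimplySMFactorizable (G : Type u) [Group G] [TopologicalSpace G] : Prop :=
  ∀ U : Set G, IsCozero U →
    ∃ (H : Type u) (_ : Group H) (_ : TopologicalSpace H) (π : G →* H),
      IsTopologicalGroup H ∧ TopologicalSpace.SeparableSpace H ∧
      TopologicalSpace.MetrizableSpace H ∧
      Continuous π ∧ Function.Surjective π ∧ π ⁻¹' (π '' U) = U

/-- `Y` is `G_δ`-dense in the space `X`: every nonempty `G_δ`-set of `X` meets `Y`. -/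
def IsGDeltaDense {X : Type u} [TopologicalSpace X] (Y : Set X) : Prop :=
  ∀ s : Set X, IsGδ s → s.Nonempty → (s ∩ Y).Nonempty

/-- The `G_δ`-closure of `Y` in `X`: the points all of whose `G_δ`-neighbourhoods meet `Y`. By
`isGreatest_gDeltaClosure` it is the biggest subset of `X` containing `Y` as a `G_δ`-dense
subset. -/
def gDeltaClosure {X : Type u} [TopologicalSpace X] (Y : Set X) : Set X :=
  {x | ∀ s : Set X, IsGδ s → x ∈ s → (s ∩ Y).Nonempty}

theorem subset_gDeltaClosure {X : Type u} [TopologicalSpace X] (Y : Set X) :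
    Y ⊆ gDeltaClosure Y := fun x hx _ _ hxs => ⟨x, hxs, hx⟩

theorem isGreatest_gDeltaClosure {X : Type u} [TopologicalSpace X] (Y : Set X) :
    IsGreatest {Z : Set X | Y ⊆ Z ∧ IsGDeltaDense ((fun z : Z => (z : X)) ⁻¹' Y)}
      (gDeltaClosure Y) := by
  refine ⟨⟨subset_gDeltaClosure Y, ?_⟩, ?_⟩
  · rintro s hs ⟨z, hz⟩
    obtain ⟨T, hTo, hTc, rfl⟩ := hs
    choose! V hVo hV using fun t (ht : t ∈ T) => isOpen_induced_iff.1 (hTo t ht)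
    obtain ⟨y, hy, hyY⟩ := z.2 (⋂ t ∈ T, V t)
      (IsGδ.biInter_of_isOpen hTc hVo) (by
        simp only [mem_iInter]
        intro t ht
        have h := hz t ht
        rw [← hV t ht] at h
        exact h)
    refine ⟨⟨y, subset_gDeltaClosure Y hyY⟩, ?_, hyY⟩
    intro t ht
    rw [← hV t ht]
    simp only [mem_iInter] at hy
    exact hy t ht
  · rintro Z ⟨-, hZ⟩ x hx s hs hxs
    obtain ⟨z, hz, hzY⟩ := hZ ((fun z : Z => (z : X)) ⁻¹' s)
      (hs.preimage continuous_subtype_val) ⟨⟨x, hx⟩, hxs⟩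
    exact ⟨z, hz, hzY⟩

/-- The two-sided (Raĭkov) uniformity of a topological group: the coarsest uniformity finer than
both the left and the right uniformity. -/
abbrev twoSidedUniformSpace (G : Type u) [Group G] [TopologicalSpace G] [IsTopologicalGroup G] :
    UniformSpace G :=
  IsTopologicalGroup.leftUniformSpace G ⊓ IsTopologicalGroup.rightUniformSpace G

theorem twoSidedUniformSpace_toTopologicalSpace (G : Type u) [Group G] [t : TopologicalSpace G]
    [IsTopologicalGroup G] : (twoSidedUniformSpace G).toTopologicalSpace = t :=
  inf_idem t

/-- The Raĭkov completion `ϱG` (as a space): the Hausdorff completion of `G` with respect to the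
two-sided uniformity. -/
def RaikovCompletion (G : Type u) [Group G] [TopologicalSpace G] [IsTopologicalGroup G] : Type u :=
  @UniformSpace.Completion G (twoSidedUniformSpace G)

instance (G : Type u) [Group G] [TopologicalSpace G] [IsTopologicalGroup G] :
    UniformSpace (RaikovCompletion G) :=
  @UniformSpace.Completion.uniformSpace G (twoSidedUniformSpace G)

/-- The canonical map `G → ϱG`. -/
def toRaikov (G : Type u) [Group G] [TopologicalSpace G] [IsTopologicalGroup G] :
    G → RaikovCompletion G :=
  @UniformSpace.Completion.coe' G (twoSidedUniformSpace G)

/-- `ϱ_ωG`: the `G_δ`-closure of `G` in its Raĭkov completion, with the subspace topology. -/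
abbrev RaikovOmega (G : Type u) [Group G] [TopologicalSpace G] [IsTopologicalGroup G] : Type u :=
  gDeltaClosure (range (toRaikov G))

/-- The canonical map `G → ϱ_ωG`. -/
def toRaikovOmega (G : Type u) [Group G] [TopologicalSpace G] [IsTopologicalGroup G] :
    G → RaikovOmega G :=
  fun x => ⟨toRaikov G x, subset_gDeltaClosure _ (mem_range_self x)⟩

/-- The fine (universal) uniformity of a completely regular space: the finest uniformity inducing
its topology. (In Mathlib's order on uniformities, the finest is the infimum.) -/
abbrev fineUniformSpace (X : Type u) [t : TopologicalSpace X] : UniformSpace X :=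
  sInf {v : UniformSpace X | v.toTopologicalSpace = t}

theorem fineUniformSpace_toTopologicalSpace (X : Type u) [t : TopologicalSpace X]
    [CompletelyRegularSpace X] : (fineUniformSpace X).toTopologicalSpace = t := by
  obtain ⟨v, hv⟩ := CompletelyRegularSpace.exists_uniformSpace (X := X)
  rw [UniformSpace.toTopologicalSpace_sInf]
  apply le_antisymm
  · exact iInf₂_le_of_le v hv (le_of_eq hv)
  · exact le_iInf₂ fun w hw => le_of_eq (Eq.symm hw)

/-- The Dieudonné completion `μX` of a completely regular space: the Hausdorff completion of `X`
with respect to its fine uniformity. -/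
def DieudonneCompletion (X : Type u) [TopologicalSpace X] : Type u :=
  @UniformSpace.Completion X (fineUniformSpace X)

instance (X : Type u) [TopologicalSpace X] : UniformSpace (DieudonneCompletion X) :=
  @UniformSpace.Completion.uniformSpace X (fineUniformSpace X)

/-- The canonical map `X → μX`. -/
def toDieudonne (X : Type u) [TopologicalSpace X] : X → DieudonneCompletion X :=
  @UniformSpace.Completion.coe' X (fineUniformSpace X)

/-- The evaluation map of `X` into the power `ℝ^C(X)`. -/
def evalMap (X : Type u) [TopologicalSpace X] : X → (C(X, ℝ) → ℝ) := fun x f => f x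

/-- The Hewitt–Nachbin realcompactification `υX` of a completely regular space: the closure of the
canonical image of `X` in `ℝ^C(X)`, with the subspace topology. -/
abbrev Realcompactification (X : Type u) [TopologicalSpace X] : Type u :=
  closure (range (evalMap X))

/-- The canonical map `X → υX`. -/
def toRealcompactification (X : Type u) [TopologicalSpace X] : X → Realcompactification X :=
  fun x => ⟨evalMap X x, subset_closure (mem_range_self x)⟩

/-- `X` is `C`-embedded in `Y` through `i`: `i` is a topological embedding and every continuous
real-valued function on `X` extends to a continuous function on `Y`. -/
def IsCEmbedding {X Y : Type u} [TopologicalSpace X] [TopologicalSpace Y] (i : X → Y) : Prop :=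
  Topology.IsEmbedding i ∧
    ∀ f : X → ℝ, Continuous f → ∃ g : Y → ℝ, Continuous g ∧ ∀ x, g (i x) = f x

/-- `G` is completion friendly: `G` is `C`-embedded in `ϱ_ωG`. -/
def IsCompletionFriendly (G : Type u) [Group G] [TopologicalSpace G] [IsTopologicalGroup G] :
    Prop :=
  IsCEmbedding (toRaikovOmega G)

/-- `G` is a `PT`-group: multiplication and inversion of `G` extend continuously to `μG`. -/
def IsPTGroup (G : Type u) [Group G] [TopologicalSpace G] : Prop :=
  (∃ m : DieudonneCompletion G × DieudonneCompletion G → DieudonneCompletion G, Continuous m ∧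
      ∀ x y : G, m (toDieudonne G x, toDieudonne G y) = toDieudonne G (x * y)) ∧
    ∃ j : DieudonneCompletion G → DieudonneCompletion G, Continuous j ∧
      ∀ x : G, j (toDieudonne G x) = toDieudonne G x⁻¹

end SMFactor

namespace SMFactor

open Set Filter Topology Uniformity

universe u

/-! All three spaces are regular Hausdorff extensions in which `G` is dense, so two of them agree
over `G` once the traces on `G` of the neighbourhood filters of each converge in the other
(`exists_homeomorph_of_isDenseInducing`). These traces are Cauchy for the fine uniformity in the
case of `μG`, satisfy `IsOmegaCauchy` in the case of `ϱ_ωG`, and are the filters `evalFilter p` in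
the case of `υG`; the first two spaces are compared with the third.

The hypothesis enters through `IsSimplySMFactorizable.exists_monoidHom`: a continuous real function
is constant on the fibres of a continuous homomorphism into a second countable metrizable group. A
fibre is cut out by countably many conditions, so a filter with `CountablyMeets` can be pinned to
one. Hence continuous functions converge along ω-Cauchy filters (`IsOmegaCauchy.exists_tendsto`),
and `evalFilter p` is ω-Cauchy (`isOmegaCauchy_evalFilter`).

For `μG` the hard point is that `evalFilter p` is Cauchy for the fine uniformity. A σ-discrete
refinement turns this into the principality of a countably complete ultrafilter on the index set of
a disjoint open family. For general spaces measurable cardinals obstruct this; here the group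
structure forbids it (`exists_singleton_of_represented`).

Products and inverses of ω-Cauchy filters are ω-Cauchy, so the operations extend to `ϱ_ωG` and are
carried over to `μG`. -/

/-- Countably many members of the filter `F` always have a common point. -/
def CountablyMeets {X : Type u} (F : Filter X) : Prop :=
  ∀ S : ℕ → Set X, (∀ n, S n ∈ F) → ∃ x, ∀ n, x ∈ S n

theorem CountablyMeets.exists_forall_mem {X : Type u} {F : Filter X} (hF : CountablyMeets F)
    {ι : Type*} [Countable ι] {S : ι → Set X} (hS : ∀ i, S i ∈ F) : ∃ x, ∀ i, x ∈ S i := by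
  obtain ⟨x, hx⟩ : ∃ x, ∀ o : Option ι, x ∈ o.elim univ S := by
    obtain ⟨e, he⟩ := exists_surjective_nat (Option ι)
    obtain ⟨x, hx⟩ := hF (fun n => (e n).elim univ S) fun n => by
      cases e n with
      | none => exact univ_mem
      | some i => exact hS i
    refine ⟨x, fun o => ?_⟩
    obtain ⟨n, rfl⟩ := he o
    exact hx n
  exact ⟨x, fun i => hx (some i)⟩

theorem CountablyMeets.neBot {X : Type u} {F : Filter X} (hF : CountablyMeets F) : F.NeBot := by
  refine ⟨fun h => ?_⟩
  obtain ⟨x, hx⟩ := hF (fun _ => ∅) fun _ => by simp [h]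
  exact hx 0

theorem CountablyMeets.map {X Y : Type u} {F : Filter X} (hF : CountablyMeets F) (f : X → Y) :
    CountablyMeets (F.map f) := fun S hS => by
  obtain ⟨x, hx⟩ := hF (fun n => f ⁻¹' S n) hS
  exact ⟨f x, hx⟩

theorem CountablyMeets.prod {X Y : Type u} {F : Filter X} {F' : Filter Y} (hF : CountablyMeets F)
    (hF' : CountablyMeets F') : CountablyMeets (F ×ˢ F') := fun S hS => by
  choose A hA B hB hAB using fun n => mem_prod_iff.1 (hS n)
  obtain ⟨x, hx⟩ := hF A hA
  obtain ⟨y, hy⟩ := hF' B hB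
  exact ⟨(x, y), fun n => hAB n ⟨hx n, hy n⟩⟩

/-! ### ω-Cauchy filters and factorization of continuous functions -/

section Group

variable {G : Type u} [Group G] [TopologicalSpace G]

/-- Filters that are Cauchy for the two-sided uniformity and countably many members of which
always meet: the filters that converge in `ϱ_ωG`. -/
structure IsOmegaCauchy (F : Filter G) : Prop where
  left : ∀ V ∈ 𝓝 (1 : G), ∃ A ∈ F, ∀ a ∈ A, ∀ b ∈ A, a⁻¹ * b ∈ V
  right : ∀ V ∈ 𝓝 (1 : G), ∃ A ∈ F, ∀ a ∈ A, ∀ b ∈ A, a * b⁻¹ ∈ V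
  countablyMeets : CountablyMeets F

theorem IsOmegaCauchy.inv {F : Filter G} (hF : IsOmegaCauchy F) :
    IsOmegaCauchy (F.map fun x => x⁻¹) where
  left V hV := by
    obtain ⟨A, hA, h⟩ := hF.right V hV
    refine ⟨A⁻¹, mem_map.2 (by simpa [preimage] using hA), fun a ha b hb => ?_⟩
    simpa using h _ ha _ hb
  right V hV := by
    obtain ⟨A, hA, h⟩ := hF.left V hV
    refine ⟨A⁻¹, mem_map.2 (by simpa [preimage] using hA), fun a ha b hb => ?_⟩
    simpa using h _ ha _ hb
  countablyMeets := hF.countablyMeets.map _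

/-- The values of `f` are determined by the sets `{f > q}` with `q` rational, so the product of the
countably many homomorphisms attached to these sets separates whatever `f` separates. Nothing is
said about continuity of the function induced on the image. -/
theorem IsSimplySMFactorizable.exists_monoidHom (hG : IsSimplySMFactorizable G) {f : G → ℝ}
    (hf : Continuous f) :
    ∃ (H : Type u) (_ : Group H) (_ : TopologicalSpace H) (π : G →* H),
      IsTopologicalGroup H ∧ SecondCountableTopology H ∧
      TopologicalSpace.MetrizableSpace H ∧ Continuous π ∧ ∀ a b, π a = π b → f a = f b := by
  have hU : ∀ q : ℚ, IsCozero {x | (q : ℝ) < f x} := fun q =>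
    ⟨fun x => max (f x - q) 0, by fun_prop, by
      ext x
      simp only [mem_ofPred_eq, ne_eq, max_eq_right_iff, not_le, sub_pos]⟩
  choose H gH tH π h₁ h₂ h₃ h₄ h₅ h₆ using fun q => hG _ (hU q)
  have : ∀ q, SecondCountableTopology (H q) := fun q => by
    let _ := TopologicalSpace.metrizableSpaceMetric (H q)
    exact UniformSpace.secondCountable_of_separable (H q)
  refine ⟨∀ q, H q, inferInstance, inferInstance, MonoidHom.pi π, inferInstance, inferInstance,
    inferInstance, continuous_pi h₄, fun a b hab => ?_⟩
  have key : ∀ a b, (∀ q, π q a = π q b) → f a ≤ f b := fun a b hab => by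
    refine le_of_forall_rat_lt_imp_le fun q hq => le_of_lt ?_
    have : b ∈ π q ⁻¹' (π q '' {x | (q : ℝ) < f x}) := ⟨a, hq, hab q⟩
    rwa [h₆ q] at this
  exact le_antisymm (key a b fun q => congrFun hab q) (key b a fun q => (congrFun hab q).symm)

variable [IsTopologicalGroup G]

theorem IsOmegaCauchy.mul {F F' : Filter G} (hF : IsOmegaCauchy F) (hF' : IsOmegaCauchy F') :
    IsOmegaCauchy ((F ×ˢ F').map fun x => x.1 * x.2) where
  left V hV := by
    have hc : Tendsto (fun w : G × G × G × G => w.1⁻¹ * w.2.1 * w.2.2.1 * w.2.2.2)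
        (𝓝 (1, 1, 1, 1)) (𝓝 1) := by
      have : Continuous (fun w : G × G × G × G => w.1⁻¹ * w.2.1 * w.2.2.1 * w.2.2.2) := by
        fun_prop
      simpa using this.tendsto (1, 1, 1, 1)
    have hW := hc hV
    simp only [nhds_prod_eq, mem_map] at hW
    obtain ⟨W₁, hW₁, T, hT, h₁⟩ := mem_prod_iff.1 hW
    obtain ⟨W₂, hW₂, T', hT', h₂⟩ := mem_prod_iff.1 hT
    obtain ⟨W₃, hW₃, W₄, hW₄, h₃⟩ := mem_prod_iff.1 hT'
    -- With `b₀` fixed in `B`, `(ab)⁻¹(a'b')` is `(b₀⁻¹b)⁻¹ · b₀⁻¹(a⁻¹a')b₀ · b₀⁻¹b · b⁻¹b'`: only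
    -- conjugation by the single element `b₀` has to be controlled.
    obtain ⟨B, hB, hBW⟩ := hF'.left (W₁ ∩ W₃ ∩ W₄) (inter_mem (inter_mem hW₁ hW₃) hW₄)
    have := hF'.countablyMeets.neBot
    obtain ⟨b₀, hb₀⟩ := Filter.nonempty_of_mem hB
    have hconj : (fun x => b₀⁻¹ * x * b₀) ⁻¹' W₂ ∈ 𝓝 (1 : G) := by
      have : Continuous fun x : G => b₀⁻¹ * x * b₀ := by fun_prop
      exact this.continuousAt.preimage_mem_nhds (by simpa using hW₂)
    obtain ⟨A, hA, hAW⟩ := hF.left _ hconj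
    refine ⟨(fun x : G × G => x.1 * x.2) '' A ×ˢ B, image_mem_map (prod_mem_prod hA hB), ?_⟩
    rintro _ ⟨⟨a, b⟩, ⟨ha, hb⟩, rfl⟩ _ ⟨⟨a', b'⟩, ⟨ha', hb'⟩, rfl⟩
    have h := h₁ (mk_mem_prod (hBW b₀ hb₀ b hb).1.1 (h₂ (mk_mem_prod (hAW a ha a' ha')
      (h₃ (mk_mem_prod (hBW b₀ hb₀ b hb).1.2 (hBW b hb b' hb').2)))))
    simp only [mem_preimage] at h
    convert h using 1
    group
  right V hV := by
    have hc : Tendsto (fun w : G × G × G × G => w.1 * w.2.1 * w.2.2.1 * w.2.2.2⁻¹)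
        (𝓝 (1, 1, 1, 1)) (𝓝 1) := by
      have : Continuous (fun w : G × G × G × G => w.1 * w.2.1 * w.2.2.1 * w.2.2.2⁻¹) := by
        fun_prop
      simpa using this.tendsto (1, 1, 1, 1)
    have hW := hc hV
    simp only [nhds_prod_eq, mem_map] at hW
    obtain ⟨W₁, hW₁, T, hT, h₁⟩ := mem_prod_iff.1 hW
    obtain ⟨W₂, hW₂, T', hT', h₂⟩ := mem_prod_iff.1 hT
    obtain ⟨W₃, hW₃, W₄, hW₄, h₃⟩ := mem_prod_iff.1 hT'
    obtain ⟨A, hA, hAW⟩ := hF.right (W₁ ∩ W₂ ∩ W₄) (inter_mem (inter_mem hW₁ hW₂) hW₄)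
    have := hF.countablyMeets.neBot
    obtain ⟨a₀, ha₀⟩ := Filter.nonempty_of_mem hA
    have hconj : (fun x => a₀ * x * a₀⁻¹) ⁻¹' W₃ ∈ 𝓝 (1 : G) := by
      have : Continuous fun x : G => a₀ * x * a₀⁻¹ := by fun_prop
      exact this.continuousAt.preimage_mem_nhds (by simpa using hW₃)
    obtain ⟨B, hB, hBW⟩ := hF'.right _ hconj
    refine ⟨(fun x : G × G => x.1 * x.2) '' A ×ˢ B, image_mem_map (prod_mem_prod hA hB), ?_⟩
    rintro _ ⟨⟨a, b⟩, ⟨ha, hb⟩, rfl⟩ _ ⟨⟨a', b'⟩, ⟨ha', hb'⟩, rfl⟩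
    have h := h₁ (mk_mem_prod (hAW a ha a' ha').1.1 (h₂ (mk_mem_prod (hAW a' ha' a₀ ha₀).1.2
      (h₃ (mk_mem_prod (hBW b hb b' hb') (hAW a' ha' a₀ ha₀).2)))))
    simp only [mem_preimage] at h
    convert h using 1
    group
  countablyMeets := (hF.countablyMeets.prod hF'.countablyMeets).map _

theorem IsOmegaCauchy.cauchy {F : Filter G} (hF : IsOmegaCauchy F) :
    Cauchy (uniformSpace := twoSidedUniformSpace G) F := by
  have := hF.countablyMeets.neBot
  refine cauchy_inf_uniformSpace.2 ⟨⟨this, ?_⟩, ⟨this, ?_⟩⟩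
  · rintro s ⟨V, hV, hs⟩
    obtain ⟨A, hA, h⟩ := hF.left V hV
    exact mem_of_superset (prod_mem_prod hA hA) fun x hx => hs (h _ hx.1 _ hx.2)
  · rintro s ⟨V, hV, hs⟩
    obtain ⟨A, hA, h⟩ := hF.right V hV
    exact mem_of_superset (prod_mem_prod hA hA) fun x hx => hs (h _ hx.2 _ hx.1)

theorem IsOmegaCauchy.of_cauchy {F : Filter G}
    (h : Cauchy (uniformSpace := twoSidedUniformSpace G) F) (hF : CountablyMeets F) :
    IsOmegaCauchy F where
  left V hV := by
    have h' := (cauchy_inf_uniformSpace.1 h).1.2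
    obtain ⟨A, hA, hs⟩ := mem_prod_same_iff.1 (h' (preimage_mem_comap hV))
    exact ⟨A, hA, fun a ha b hb => hs (mk_mem_prod ha hb)⟩
  right V hV := by
    have h' := (cauchy_inf_uniformSpace.1 h).2.2
    obtain ⟨A, hA, hs⟩ := mem_prod_same_iff.1 (h' (preimage_mem_comap hV))
    exact ⟨A, hA, fun a ha b hb => hs (mk_mem_prod hb ha)⟩
  countablyMeets := hF

/-- The limit is `f g` for any `g` in a sequence of members of `F` whose differences shrink to the
kernel of `π`. A point `g'` in these members and in a small `B` has `π g' = π g`, so `f y = f (g *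
(g'⁻¹ * y))` for `y ∈ B`, and continuity of `f` at `g` alone suffices. -/
theorem IsOmegaCauchy.exists_tendsto (hG : IsSimplySMFactorizable G) {F : Filter G}
    (hF : IsOmegaCauchy F) {f : G → ℝ} (hf : Continuous f) : ∃ c, Tendsto f F (𝓝 c) := by
  obtain ⟨H, _, _, π, _, _, _, hπ, hfπ⟩ := hG.exists_monoidHom hf
  obtain ⟨W, hW⟩ := (𝓝 (1 : H)).exists_antitone_basis
  have hmap : π ⁻¹' {1} = ⋂ n, π ⁻¹' W n := by
    rw [← preimage_iInter, ← biInter_basis_nhds hW.toHasBasis]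
    simp
  choose A hA hAW using fun n => hF.left (π ⁻¹' W n) (hπ.continuousAt.preimage_mem_nhds (by
    rw [map_one]; exact hW.mem n))
  obtain ⟨g, hg⟩ := hF.countablyMeets A hA
  refine ⟨f g, fun O hO => ?_⟩
  have hV : (fun v => f (g * v)) ⁻¹' O ∈ 𝓝 (1 : G) := by
    have : Continuous fun v => f (g * v) := by fun_prop
    exact this.continuousAt.preimage_mem_nhds (by simpa using hO)
  obtain ⟨B, hB, hBV⟩ := hF.left _ hV
  obtain ⟨g', hg'⟩ := hF.countablyMeets.exists_forall_mem (S := fun n : Option ℕ => n.elim B A)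
    (fun n => by cases n <;> simp [hA, hB])
  have hgg : π g = π g' := by
    have : g⁻¹ * g' ∈ π ⁻¹' {1} := by
      rw [hmap]
      exact mem_iInter.2 fun n => hAW n g (hg n) g' (hg' (some n))
    rw [mem_preimage, map_mul, map_inv, mem_singleton_iff, inv_mul_eq_one] at this
    exact this
  refine mem_map.2 (mem_of_superset hB fun y hy => ?_)
  have := hBV g' (hg' none) y hy
  rwa [mem_preimage, hfπ (g * (g'⁻¹ * y)) y (by simp [hgg])] at this

end Group

/-! ### Countably complete ultrafilters and disjoint open families -/

section Ultra

variable {I : Type u} {D : Set I} {𝒰 : Set I → Prop}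

/-- If countably many values of a family `𝒰` of sets are always those of a principal ultrafilter,
then every map to the Cantor set is constant on a member of `𝒰`. -/
theorem exists_const_of_represented
    (h𝒰 : ∀ J : ℕ → Set I, ∃ i ∈ D, ∀ n, 𝒰 (J n) ↔ i ∈ J n) (c : I → ℕ → Prop) :
    ∃ q, 𝒰 {i | c i = q} := by
  refine ⟨fun n => 𝒰 {i | c i n}, ?_⟩
  -- Slot `0` tests the set in question; the later slots make the representing `i` satisfy `c i =
  -- q`.
  obtain ⟨i, -, hi⟩ := h𝒰 fun n => Nat.casesOn n {i | c i = fun n => 𝒰 {i | c i n}}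
    fun n => {i | c i n}
  refine (hi 0).2 ?_
  funext n
  exact propext (hi (n + 1)).symm

theorem exists_mem_of_represented
    (h𝒰 : ∀ J : ℕ → Set I, ∃ i ∈ D, ∀ n, 𝒰 (J n) ↔ i ∈ J n) {A B C E : Set I}
    (hA : 𝒰 A) (hB : 𝒰 B) (hC : 𝒰 C) (hE : ¬ 𝒰 E) : ∃ i ∈ D, i ∈ A ∧ i ∈ B ∧ i ∈ C ∧ i ∉ E := by
  obtain ⟨i, hD, hi⟩ := h𝒰 fun n => match n with
    | 0 => A
    | 1 => B
    | 2 => C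
    | _ => E
  exact ⟨i, hD, (hi 0).1 hA, (hi 1).1 hB, (hi 2).1 hC, fun h => hE ((hi 3).2 h)⟩

end Ultra

section Group

variable {G : Type u} [Group G] [TopologicalSpace G]

theorem completelyRegularSpace_of_isTopologicalGroup (G : Type u) [Group G] [TopologicalSpace G]
    [IsTopologicalGroup G] : CompletelyRegularSpace G :=
  .of_exists_uniformSpace ⟨IsTopologicalGroup.leftUniformSpace G, rfl⟩

/-- Every neighbourhood of `1` contains a normal subgroup the cosets of which are coded by points
of the Cantor set. -/
theorem IsSimplySMFactorizable.exists_code [CompletelyRegularSpace G]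
    (hG : IsSimplySMFactorizable G) {V : Set G} (hV : V ∈ 𝓝 1) :
    ∃ C : G → ℕ → Prop, (∀ a b, C a = C b → ∀ c d, C (c * a * d) = C (c * b * d)) ∧
      ∀ a, C a = C 1 → a ∈ V := by
  obtain ⟨f, hf, hf1, hfV⟩ := CompletelyRegularSpace.completely_regular_isOpen (1 : G)
    (interior V) isOpen_interior (mem_interior_iff_mem_nhds.2 hV)
  obtain ⟨H, _, _, π, _, _, _, -, hfπ⟩ :=
    hG.exists_monoidHom (f := fun x => (f x : ℝ)) (by fun_prop)
  -- The code of `a` records which members of a countable base of `H` contain `π a`; since `H` is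
  -- Hausdorff, it determines `π a`.
  obtain ⟨B₀, hB₀, -⟩ := (TopologicalSpace.isBasis_countableBasis H).exists_subset_of_mem_open
    (mem_univ (1 : H)) isOpen_univ
  obtain ⟨B, hB⟩ := (TopologicalSpace.countable_countableBasis H).exists_eq_range ⟨B₀, hB₀⟩
  have hC : ∀ x y : H, (fun n => x ∈ B n) = (fun n => y ∈ B n) → x = y := fun x y hxy => by
    refine ((TopologicalSpace.isBasis_countableBasis H).inseparable_iff.2 ?_).eq
    rw [hB]
    rintro _ ⟨n, rfl⟩
    exact iff_of_eq (congrFun hxy n)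
  refine ⟨fun a n => π a ∈ B n, fun a b hab c d => ?_, fun a ha => ?_⟩
  · simp only [map_mul, hC _ _ hab]
  · by_contra haV
    have h1 : (f a : ℝ) = 1 := by
      rw [hfV fun h => haV (interior_subset h)]
      rfl
    have h0 := hfπ a 1 (hC _ _ ha)
    rw [h1, hf1] at h0
    simp at h0

/-- A family of disjoint open sets in a simply `sm`-factorizable group does not carry a
nonprincipal countably complete ultrafilter. -/
theorem IsSimplySMFactorizable.exists_singleton_of_represented [ContinuousMul G]
    [CompletelyRegularSpace G]
    (hG : IsSimplySMFactorizable G) {I : Type u} {U : I → Set G} (hUo : ∀ i, IsOpen (U i))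
    (hU : ∀ i j, i ≠ j → Disjoint (U i) (U j)) {𝒰 : Set I → Prop}
    (h𝒰 : ∀ J : ℕ → Set I, ∃ i ∈ {i | (U i).Nonempty}, ∀ n, 𝒰 (J n) ↔ i ∈ J n) :
    ∃ i, 𝒰 {i} := by
  by_contra! hne
  have hg : ∀ i, ∃ g, (U i).Nonempty → g ∈ U i := fun i => by
    by_cases h : (U i).Nonempty
    · exact ⟨h.some, fun _ => h.some_mem⟩
    · exact ⟨1, fun h' => absurd h' h⟩
  choose g hg using hg
  have hC : ∀ i, ∃ C : G → ℕ → Prop,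
      (∀ a b, C a = C b → ∀ c d, C (c * a * d) = C (c * b * d)) ∧
      ((U i).Nonempty → ∀ a, C a = C 1 → g i * a ∈ U i) := fun i => by
    by_cases h : (U i).Nonempty
    · obtain ⟨C, h₁, h₂⟩ := hG.exists_code (V := (fun a => g i * a) ⁻¹' U i)
        ((continuous_const_mul (g i)).continuousAt.preimage_mem_nhds
          (by simpa using (hUo i).mem_nhds (hg i h)))
      exact ⟨C, h₁, fun _ => h₂⟩
    · exact ⟨fun _ _ => True, fun _ _ _ _ _ => rfl, fun h' => absurd h' h⟩
  choose C hCc hCU using hC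
  -- For most `j`, `C i (g j)` is `r i` and `C j (g i)` is `s i`; for most `i`, `s i` is the common
  -- value `q`.
  choose r hr using fun i => exists_const_of_represented h𝒰 fun j => C i (g j)
  choose s hs using fun i => exists_const_of_represented h𝒰 fun j => C j (g i)
  obtain ⟨q, hq⟩ := exists_const_of_represented h𝒰 s
  obtain ⟨i, hi, hiq, -⟩ := exists_mem_of_represented h𝒰 hq hq hq (hne (h𝒰 fun _ => ∅).choose)
  obtain ⟨k, -, hkq, hkr, -⟩ := exists_mem_of_represented h𝒰 hq (hr i) hq (hne i)
  obtain ⟨j, hj, hjr, hji, hjk, hij⟩ :=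
    exists_mem_of_represented h𝒰 (hr i) (hs i) (hs k) (hne i)
  simp only [mem_ofPred_eq] at hiq hkq hkr hjr hji hjk
  -- The point `g i * (g k)⁻¹ * g j` lies in `U i` because `g j` and `g k` have equal `i`-codes, and
  -- in `U j` because `g i` and `g k` have equal `j`-codes.
  refine Set.disjoint_left.1 (hU i j fun h => hij h.symm)
    (show g i * (g k)⁻¹ * g j ∈ U i from ?_) ?_
  · have := hCc i _ _ (hjr.trans hkr.symm) (g k)⁻¹ 1
    simp only [mul_one, inv_mul_cancel] at this
    simpa [mul_assoc] using hCU i hi _ this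
  · have := hCc j (g i) (g k) (by rw [hji, hjk, hiq, hkq]) (g j)⁻¹ ((g k)⁻¹ * g j)
    rw [show (g j)⁻¹ * g k * ((g k)⁻¹ * g j) = 1 by group] at this
    have := hCU j hj _ this
    simpa [mul_assoc] using this

end Group

/-! ### Points of the realcompactification as filters -/

section Realcompact

variable {X : Type u} [TopologicalSpace X] {p : C(X, ℝ) → ℝ}

/-- The trace on `X` of the neighbourhoods of a point of `ℝ^C(X)`. -/
abbrev evalFilter (p : C(X, ℝ) → ℝ) : Filter X := comap (evalMap X) (𝓝 p)

theorem tendsto_evalFilter (p : C(X, ℝ) → ℝ) (f : C(X, ℝ)) :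
    Tendsto f (evalFilter p) (𝓝 (p f)) :=
  ((continuous_apply f).tendsto p).comp (tendsto_comap (f := evalMap X))

/-- If the sets had no common point, a series of functions vanishing at `p` would be nowhere zero on
`X`. Its reciprocal would be a continuous function with finite limit along the filter, although the
series tends to `0`. -/
theorem countablyMeets_evalFilter (hp : p ∈ closure (range (evalMap X))) :
    CountablyMeets (evalFilter p) := fun S hS => by
  have hne : (evalFilter p).NeBot := by
    refine comap_neBot fun t ht => ?_
    obtain ⟨_, ht', x, rfl⟩ := mem_closure_iff_nhds.1 hp t ht
    exact ⟨x, ht'⟩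
  choose W hW hWS using fun n => mem_comap.1 (hS n)
  choose h hc hp0 h1 using fun n => CompletelyRegularSpace.completely_regular_isOpen p
    (interior (W n)) isOpen_interior (mem_interior_iff_mem_nhds.2 (hW n))
  set T : (C(X, ℝ) → ℝ) → ℝ := fun z => ∑' n, (1 / 2 : ℝ) ^ n * h n z with hT
  have hle : ∀ n z, ‖(1 / 2 : ℝ) ^ n * h n z‖ ≤ (1 / 2 : ℝ) ^ n := fun n z => by
    rw [norm_mul, Real.norm_of_nonneg (by positivity), Real.norm_of_nonneg (h n z).2.1]
    exact mul_le_of_le_one_right (by positivity) (h n z).2.2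
  have hTc : Continuous T :=
    continuous_tsum (fun n => by have := hc n; fun_prop) summable_geometric_two hle
  have hTp : T p = 0 := by simp [hT, hp0]
  by_contra! hx
  have hpos : ∀ x, T (evalMap X x) ≠ 0 := fun x => by
    obtain ⟨n, hn⟩ := hx x
    have hs : Summable fun n => (1 / 2 : ℝ) ^ n * h n (evalMap X x) :=
      Summable.of_norm_bounded summable_geometric_two fun n => hle n _
    refine (hs.tsum_pos (fun i => mul_nonneg (by positivity) (h i _).2.1) n ?_).ne'
    rw [h1 n (x := evalMap X x) fun hi => hn (hWS n (interior_subset (s := W n) hi))]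
    simp
  have hec : Continuous (evalMap X) := continuous_pi fun f => f.continuous
  let f : C(X, ℝ) := ⟨fun x => (T (evalMap X x))⁻¹, (hTc.comp hec).inv₀ hpos⟩
  have h₀ : Tendsto (fun x => T (evalMap X x)) (evalFilter p) (𝓝 0) := by
    rw [← hTp]
    exact (hTc.tendsto p).comp tendsto_comap
  have h₁ := (tendsto_evalFilter p f).mul h₀
  have h₂ : (fun x => f x * T (evalMap X x)) = fun _ => 1 :=
    funext fun x => inv_mul_cancel₀ (hpos x)
  rw [h₂, mul_zero] at h₁
  exact one_ne_zero (tendsto_nhds_unique tendsto_const_nhds h₁)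

theorem exists_forall_apply_eq (hp : p ∈ closure (range (evalMap X))) {ι : Type*} [Countable ι]
    (f : ι → C(X, ℝ)) : ∃ x, ∀ i, f i x = p (f i) := by
  obtain ⟨x, hx⟩ := (countablyMeets_evalFilter hp).exists_forall_mem
    (S := fun i : ι × ℕ => f i.1 ⁻¹' Metric.ball (p (f i.1)) (1 / (i.2 + 1))) fun i =>
      tendsto_evalFilter p (f i.1) (Metric.ball_mem_nhds _ Nat.one_div_pos_of_nat)
  refine ⟨x, fun i => dist_le_zero.1 (le_of_forall_pos_lt_add fun ε hε => ?_)⟩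
  obtain ⟨n, hn⟩ := exists_nat_one_div_lt hε
  rw [zero_add]
  exact (hx (i, n)).trans hn

end Realcompact

/-! ### Traces of points of `υG` are ω-Cauchy -/

section Group

variable {G : Type u} [Group G] [TopologicalSpace G]
  {p : C(G, ℝ) → ℝ}

/-- Distances to a dense sequence of `H` determine `π g`, so countably many functions fix the coset
of `g`. Adding any one invariant `h` to the list yields a point of the same coset, where `h` takes
the value `h g`. -/
theorem IsSimplySMFactorizable.exists_apply_eq_of_invariant (hG : IsSimplySMFactorizable G)
    (hp : p ∈ closure (range (evalMap G))) {f : G → ℝ} (hf : Continuous f) :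
    ∃ (N : Subgroup G) (g : G), N.Normal ∧ (∀ a, ∀ n ∈ N, f (a * n) = f a) ∧
      ∀ h : C(G, ℝ), (∀ a, ∀ n ∈ N, h (a * n) = h a) → p h = h g := by
  obtain ⟨H, _, _, π, _, _, _, hπ, hfπ⟩ := hG.exists_monoidHom hf
  let _ := TopologicalSpace.metrizableSpaceMetric H
  let d : ℕ → C(G, ℝ) := fun n => ⟨fun x => dist (π x) (TopologicalSpace.denseSeq H n), by fun_prop⟩
  obtain ⟨g, hg⟩ := exists_forall_apply_eq hp d
  refine ⟨π.ker, g, inferInstance, fun a n hn => hfπ _ _ (by simp [π.mem_ker.1 hn]), fun h hh => ?_⟩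
  obtain ⟨y, hy⟩ := exists_forall_apply_eq hp fun o : Option ℕ => o.elim h d
  have hyg : π y = π g := by
    have h₁ : (fun z => dist (π y) z) = fun z => dist (π g) z :=
      Continuous.ext_on (TopologicalSpace.denseRange_denseSeq H) (by fun_prop) (by fun_prop) (by
        rintro _ ⟨n, rfl⟩
        exact (hy (some n)).trans (hg n).symm)
    simpa using congrFun h₁ (π g)
  have h₂ := hh g (g⁻¹ * y) (π.mem_ker.2 (by simp [hyg]))
  rw [mul_inv_cancel_left] at h₂
  rw [← h₂]
  exact (hy none).symm

variable [IsTopologicalGroup G]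

theorem IsSimplySMFactorizable.isOmegaCauchy_evalFilter (hG : IsSimplySMFactorizable G)
    (hp : p ∈ closure (range (evalMap G))) : IsOmegaCauchy (evalFilter p) := by
  have := completelyRegularSpace_of_isTopologicalGroup G
  have key : ∀ V ∈ 𝓝 (1 : G), ∃ g, (∀ᶠ y in evalFilter p, g⁻¹ * y ∈ V) ∧
      ∀ᶠ y in evalFilter p, y * g⁻¹ ∈ V := fun V hV => by
    obtain ⟨f, hf, hf1, hfV⟩ := CompletelyRegularSpace.completely_regular_isOpen (1 : G)
      (interior V) isOpen_interior (mem_interior_iff_mem_nhds.2 hV)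
    have hfV' : ∀ x, (f x : ℝ) < 1 → x ∈ V := fun x hx => by
      by_contra h
      rw [hfV fun h' => h (interior_subset h')] at hx
      simp at hx
    obtain ⟨N, g, hN, hfN, hg⟩ := hG.exists_apply_eq_of_invariant hp
      (f := fun x => (f x : ℝ)) (by fun_prop)
    -- Both translates are `N`-invariant, the second by normality, so `p` evaluates them at `g`,
    -- where each equals `f 1 = 0`.
    let f₁ : C(G, ℝ) := ⟨fun y => f (g⁻¹ * y), by fun_prop⟩
    let f₂ : C(G, ℝ) := ⟨fun y => f (y * g⁻¹), by fun_prop⟩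
    have h₁ : p f₁ = 0 := by
      rw [hg f₁ fun a n hn => by simpa [f₁, mul_assoc] using hfN (g⁻¹ * a) n hn]
      simp [f₁, hf1]
    have h₂ : p f₂ = 0 := by
      rw [hg f₂ fun a n hn => by
        simpa [f₂, mul_assoc] using hfN (a * g⁻¹) _ (hN.conj_mem n hn g)]
      simp [f₂, hf1]
    have t₁ := tendsto_evalFilter p f₁
    have t₂ := tendsto_evalFilter p f₂
    rw [h₁] at t₁
    rw [h₂] at t₂
    exact ⟨g, (t₁.eventually (gt_mem_nhds one_pos)).mono fun y hy => hfV' _ hy,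
      (t₂.eventually (gt_mem_nhds one_pos)).mono fun y hy => hfV' _ hy⟩
  have hdiv : ∀ V ∈ 𝓝 (1 : G), ∃ W ∈ 𝓝 (1 : G), ∀ v ∈ W, ∀ w ∈ W, v⁻¹ * w ∈ V ∧ v * w⁻¹ ∈ V :=
    fun V hV => by
      have h₁ : Tendsto (fun x : G × G => x.1⁻¹ * x.2) (𝓝 (1, 1)) (𝓝 1) := by
        have : Continuous (fun x : G × G => x.1⁻¹ * x.2) := by fun_prop
        simpa using this.tendsto (1, 1)
      have h₂ : Tendsto (fun x : G × G => x.1 * x.2⁻¹) (𝓝 (1, 1)) (𝓝 1) := by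
        have : Continuous (fun x : G × G => x.1 * x.2⁻¹) := by fun_prop
        simpa using this.tendsto (1, 1)
      have h := inter_mem (mem_map.1 (h₁ hV)) (mem_map.1 (h₂ hV))
      rw [nhds_prod_eq, mem_prod_same_iff] at h
      obtain ⟨W, hW, hWV⟩ := h
      exact ⟨W, hW, fun v hv w hw => hWV (mk_mem_prod hv hw)⟩
  refine ⟨fun V hV => ?_, fun V hV => ?_, countablyMeets_evalFilter hp⟩
  · obtain ⟨W, hW, hWV⟩ := hdiv V hV
    obtain ⟨g, hg, -⟩ := key W hW
    exact ⟨_, hg, fun a ha b hb => by simpa using (hWV _ ha _ hb).1⟩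
  · obtain ⟨W, hW, hWV⟩ := hdiv V hV
    obtain ⟨g, -, hg⟩ := key W hW
    exact ⟨_, hg, fun a ha b hb => by simpa using (hWV _ ha _ hb).2⟩

end Group

/-! ### Traces of points of `υG` are Cauchy for the fine uniformity -/

section Metric

/-- Every entourage of a uniform space contains a ball of a uniformly continuous pseudometric. -/
theorem exists_pseudoMetricSpace_of_mem_uniformity {X : Type u} [u : UniformSpace X]
    {V : Set (X × X)} (hV : V ∈ 𝓤 X) :
    ∃ m : PseudoMetricSpace X, u ≤ m.toUniformSpace ∧ ∃ ε > 0, ∀ x y, m.dist x y < ε → (x, y) ∈ V := by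
  have hstep : ∀ W : {W : SetRel X X // W ∈ 𝓤 X}, ∃ W' : {W : SetRel X X // W ∈ 𝓤 X},
      (∀ x y, (x, y) ∈ W'.1 → (y, x) ∈ W'.1) ∧
      ∀ x y z, (x, y) ∈ W'.1 → (y, z) ∈ W'.1 → (x, z) ∈ W.1 := fun W => by
    obtain ⟨t, ht, hs, hc⟩ := comp_symm_mem_uniformity_sets W.2
    exact ⟨⟨t, ht⟩, fun x y h => hs.symm x y h, fun x y z h h' => hc ⟨y, h, h'⟩⟩
  choose next hsymm hcomp using hstep
  -- Starting at `next ⟨V, hV⟩` instead of `V` makes `W 0` symmetric as well.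
  let W : ℕ → {W : SetRel X X // W ∈ 𝓤 X} := fun n => next^[n] (next ⟨V, hV⟩)
  have hW : ∀ n, W (n + 1) = next (W n) := fun n => Function.iterate_succ_apply' _ _ _
  have hWs : ∀ n x y, (x, y) ∈ (W n).1 → (y, x) ∈ (W n).1 := fun n => by
    cases n with
    | zero => exact hsymm _
    | succ n => rw [hW]; exact hsymm _
  have hWc : ∀ n x y z, (x, y) ∈ (W (n + 1)).1 → (y, z) ∈ (W (n + 1)).1 → (x, z) ∈ (W n).1 :=
    fun n => by rw [hW]; exact hcomp _
  have hrefl : ∀ y, (y, y) ∈ (W 0).1 := fun y => refl_mem_uniformity (W 0).2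
  have hanti : Antitone fun n => (W n).1 := antitone_nat_of_succ_le fun n ⟨x, y⟩ hxy =>
    hWc n x y y hxy (refl_mem_uniformity (W (n + 1)).2)
  have hb : (⨅ n, 𝓟 (W n).1).HasBasis (fun _ => True) fun n => (W n).1 :=
    hasBasis_iInf_principal hanti.directed_ge
  let c : UniformSpace.Core X :=
    { uniformity := ⨅ n, 𝓟 (W n).1
      refl := le_iInf fun n => principal_mono.2 fun ⟨x, y⟩ hxy => by
        have hxy : x = y := hxy
        exact hxy ▸ refl_mem_uniformity (W n).2
      symm := (hb.tendsto_iff hb).2 fun n _ => ⟨n, trivial, fun x hx => hWs n _ _ hx⟩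
      comp := ((hb.lift' (monotone_id.relComp monotone_id)).le_basis_iff hb).2 fun n _ =>
        ⟨n + 1, trivial, fun ⟨x, z⟩ ⟨y, h, h'⟩ => hWc n x y z h h'⟩ }
  let u' : UniformSpace X := .ofCore c
  have hcg : 𝓤[u'].IsCountablyGenerated := by
    change (⨅ n, 𝓟 (W n).1).IsCountablyGenerated
    infer_instance
  have hle : u ≤ u' := show 𝓤[u] ≤ ⨅ n, 𝓟 (W n).1 from le_iInf fun n => le_principal_iff.2 (W n).2
  obtain ⟨m, hm⟩ := @UniformSpace.metrizable_uniformity X u' hcg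
  have h0 : (W 0).1 ∈ 𝓤[m.toUniformSpace] := by
    rw [hm]
    exact hb.mem_of_mem trivial
  obtain ⟨ε, hε, h⟩ := Metric.mem_uniformity_dist.1 h0
  exact ⟨m, hm ▸ hle, ε, hε, fun x y hxy => hcomp ⟨V, hV⟩ x y y (h hxy) (hrefl y)⟩

/-- A `σ`-discrete refinement of the cover of a pseudometric space by balls of a given radius. -/
theorem exists_sigma_discrete_refinement (M : Type u) [PseudoMetricSpace M] {ε : ℝ} (hε : 0 < ε) :
    ∃ T : ℕ → M → Set M, (∀ x, ∃ n i, x ∈ T n i) ∧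
      (∀ n i j, ∀ x ∈ T n i, ∀ y ∈ T n j, dist x y < 1 / (n + 1 : ℝ) → i = j) ∧
      ∀ n i, ∀ x ∈ T n i, dist x i ≤ ε - 1 / (n + 1 : ℝ) := by
  -- Stone's construction: `x` is assigned to the first centre within `ε`, and `n` records how much
  -- room is left.
  let r : M → M → Prop := WellOrderingRel
  refine ⟨fun n i => {x | dist x i ≤ ε - 1 / (n + 1 : ℝ) ∧ ∀ j, r j i → ε ≤ dist x j},
    fun x => ?_, fun n i j x hx y hy hxy => ?_, fun n i x hx => hx.1⟩
  · have hne : {i | dist x i < ε}.Nonempty := ⟨x, by simpa using hε⟩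
    have hwf : WellFounded r := WellOrderingRel.isWellOrder.wf
    obtain ⟨n, hn⟩ := exists_nat_one_div_lt (K := ℝ) (sub_pos.2 (hwf.min_mem _ hne))
    refine ⟨n, hwf.min _ hne, by linarith, fun j hj => ?_⟩
    by_contra! h
    exact hwf.not_lt_min _ h hj
  · have key : ∀ i j x y, dist x i ≤ ε - 1 / (n + 1 : ℝ) → (∀ k, r k j → ε ≤ dist y k) →
        dist x y < 1 / (n + 1 : ℝ) → ¬ r i j := fun i j x y hx hy hxy hij => by
      have h₁ := hy i hij
      have h₂ := dist_triangle_left y i x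
      linarith
    rcases trichotomous_of r i j with h | h | h
    · exact (key i j x y hx.1 hy.2 hxy h).elim
    · exact h
    · exact (key j i y x hy.1 hx.2 (by rwa [dist_comm]) h).elim

/-- The distance to a set, truncated at `1` (and equal to `1` for the empty set). -/
noncomputable def truncInfDist {M : Type u} [PseudoMetricSpace M] (A : Set M) (x : M) : ℝ :=
  (min 1 (Metric.infEDist x A)).toReal

variable {M : Type u} [PseudoMetricSpace M]

theorem continuous_truncInfDist (A : Set M) : Continuous (truncInfDist A) :=
  ENNReal.continuousOn_toReal.comp_continuous (continuous_const.min Metric.continuous_infEDist)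
    fun _ => ((min_le_left _ _).trans_lt ENNReal.one_lt_top).ne

theorem truncInfDist_eq_zero {A : Set M} {x : M} : truncInfDist A x = 0 ↔ x ∈ closure A := by
  rw [Metric.mem_closure_iff_infEDist_zero, truncInfDist, ENNReal.toReal_eq_zero_iff]
  refine ⟨fun h => ?_, fun h => Or.inl (by simp [h])⟩
  rcases h with h | h
  · rcases min_choice 1 (Metric.infEDist x A) with h' | h' <;> simp_all
  · exact absurd h ((min_le_left _ _).trans_lt ENNReal.one_lt_top).ne

theorem mem_thickening_of_truncInfDist_lt {A : Set M} {x : M} {δ : ℝ}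
    (h : truncInfDist A x < min 1 δ) : x ∈ Metric.thickening δ A := by
  have hfin := ((min_le_left 1 (Metric.infEDist x A)).trans_lt ENNReal.one_lt_top).ne
  have h₁ := (ENNReal.lt_ofReal_iff_toReal_lt hfin).2 (h.trans_le (min_le_left _ _))
  have h₂ := (ENNReal.lt_ofReal_iff_toReal_lt hfin).2 (h.trans_le (min_le_right _ _))
  rw [ENNReal.ofReal_one] at h₁
  have h₃ := (min_lt_iff.1 h₁).resolve_left (lt_irrefl _)
  rwa [min_eq_right h₃.le] at h₂

/-- Some layer `T n` has `p` in the closure of its union, in the sense that the distance function to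
it vanishes at `p`. The sets of indices whose pieces still have this property behave as a countably
complete ultrafilter, because countably many such conditions are realized at a point of `G`, and
that point is near only one piece. Principality then confines the filter to one piece. -/
theorem IsSimplySMFactorizable.exists_eventually_dist_lt {G : Type u} [Group G]
    [TopologicalSpace G] [ContinuousMul G] [CompletelyRegularSpace G]
    (hG : IsSimplySMFactorizable G) {p : C(G, ℝ) → ℝ} (hp : p ∈ closure (range (evalMap G)))
    {φ : G → M} (hφ : Continuous φ) {ε : ℝ} (hε : 0 < ε) :
    ∃ m, ∀ᶠ y in evalFilter p, dist (φ y) m < ε := by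
  obtain ⟨T, hT₁, hT₂, hT₃⟩ := exists_sigma_discrete_refinement M hε
  let d : Set M → C(G, ℝ) := fun A => ⟨truncInfDist A ∘ φ, (continuous_truncInfDist A).comp hφ⟩
  have hrep : ∀ A : ℕ → Set M, ∃ y, ∀ k, p (d (A k)) = 0 ↔ φ y ∈ closure (A k) := fun A => by
    obtain ⟨y, hy⟩ := exists_forall_apply_eq hp fun k => d (A k)
    exact ⟨y, fun k => by rw [← hy k, ← truncInfDist_eq_zero]; rfl⟩
  obtain ⟨n, hn⟩ : ∃ n, p (d (⋃ i, T n i)) = 0 := by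
    obtain ⟨y, hy⟩ := hrep fun n => ⋃ i, T n i
    obtain ⟨n, i, hi⟩ := hT₁ (φ y)
    exact ⟨n, (hy n).2 (subset_closure (mem_iUnion.2 ⟨i, hi⟩))⟩
  set δ : ℝ := 1 / (n + 1 : ℝ) with hδ
  have hδ0 : 0 < δ := Nat.one_div_pos_of_nat
  obtain ⟨i, hi⟩ := hG.exists_singleton_of_represented
    (U := fun i => φ ⁻¹' Metric.thickening (δ / 2) (T n i))
    (𝒰 := fun J => p (d (⋃ i ∈ J, T n i)) = 0)
    (fun i => Metric.isOpen_thickening.preimage hφ)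
    (fun i j hij => Set.disjoint_left.2 fun x hx hy => by
      obtain ⟨z, hz, hxz⟩ := Metric.mem_thickening_iff.1 hx
      obtain ⟨w, hw, hxw⟩ := Metric.mem_thickening_iff.1 hy
      refine hij (hT₂ n i j z hz w hw ?_)
      linarith [dist_triangle_left z w (φ x)])
    (fun J => by
      -- Slot `0` keeps `y` close to the layer, so that a nearest index `i` exists.
      obtain ⟨y, hy⟩ := hrep fun k => Nat.casesOn k (⋃ i, T n i) fun k => ⋃ i ∈ J k, T n i
      have hy0 := (hy 0).1 hn
      obtain ⟨z, hz, hyz⟩ := Metric.mem_closure_iff.1 hy0 (δ / 2) (half_pos hδ0)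
      obtain ⟨i, hi⟩ := mem_iUnion.1 hz
      have huniq : ∀ j, ∀ w ∈ T n j, dist (φ y) w < δ / 2 → i = j := fun j w hw hyw =>
        hT₂ n i j z hi w hw (by linarith [dist_triangle_left z w (φ y)])
      refine ⟨i, ⟨y, Metric.mem_thickening_iff.2 ⟨z, hi, hyz⟩⟩, fun k => (hy (k + 1)).trans ?_⟩
      refine ⟨fun h => ?_, fun h => Metric.mem_closure_iff.2 fun e he => ?_⟩
      · obtain ⟨w, hw, hyw⟩ := Metric.mem_closure_iff.1 h (δ / 2) (half_pos hδ0)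
        obtain ⟨j, hj, hwj⟩ := mem_iUnion₂.1 hw
        rwa [huniq j w hwj hyw]
      · obtain ⟨w, hw, hyw⟩ := Metric.mem_closure_iff.1 hy0 (min e (δ / 2))
          (lt_min he (half_pos hδ0))
        obtain ⟨j, hj⟩ := mem_iUnion.1 hw
        have hij := huniq j w hj (hyw.trans_le (min_le_right _ _))
        exact ⟨w, mem_iUnion₂.2 ⟨i, h, hij ▸ hj⟩, hyw.trans_le (min_le_left _ _)⟩)
  simp only [mem_singleton_iff, iUnion_iUnion_eq_left] at hi
  have ht := tendsto_evalFilter p (d (T n i))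
  rw [hi] at ht
  refine ⟨i, (ht.eventually (gt_mem_nhds (lt_min one_pos hδ0))).mono fun y hy => ?_⟩
  obtain ⟨z, hz, hyz⟩ := Metric.mem_thickening_iff.1 (mem_thickening_of_truncInfDist_lt hy)
  linarith [dist_triangle (φ y) z i, hT₃ n i z hz]

theorem IsSimplySMFactorizable.cauchy_fine_evalFilter {G : Type u} [Group G]
    [t : TopologicalSpace G] [ContinuousMul G] [CompletelyRegularSpace G]
    (hG : IsSimplySMFactorizable G) {p : C(G, ℝ) → ℝ} (hp : p ∈ closure (range (evalMap G))) :
    Cauchy (uniformSpace := fineUniformSpace G) (evalFilter p) := by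
  refine ⟨(countablyMeets_evalFilter hp).neBot, fun V hV => ?_⟩
  obtain ⟨m, hm, ε, hε, hV⟩ :=
    @exists_pseudoMetricSpace_of_mem_uniformity G (fineUniformSpace G) V hV
  have hc : @Continuous G G t m.toUniformSpace.toTopologicalSpace id := by
    have := UniformSpace.toTopologicalSpace_mono hm
    rw [fineUniformSpace_toTopologicalSpace] at this
    exact continuous_id_iff_le.2 this
  obtain ⟨x, hx⟩ := hG.exists_eventually_dist_lt hp hc (half_pos hε)
  refine mem_of_superset (prod_mem_prod hx hx) fun ⟨y, z⟩ ⟨hy, hz⟩ => hV y z ?_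
  have hy : dist y x < ε / 2 := hy
  have hz : dist z x < ε / 2 := hz
  have := dist_triangle_right y z x
  linarith

end Metric

/-! ### Comparison of dense extensions -/

section DenseInducing

theorem comap_codRestrict_nhds {X Y : Type u} [TopologicalSpace Y] {e : X → Y} {A : Set Y} (hA : ∀ x, e x ∈ A) (y : A) :
    comap (A.codRestrict e hA) (𝓝 y) = comap e (𝓝 y) := by
  rw [nhds_subtype, comap_comap]
  rfl

variable {X Y Z : Type u} [TopologicalSpace X] [TopologicalSpace Y] [TopologicalSpace Z]

/-- Two regular Hausdorff extensions of a space in which the same traces of neighbourhood filters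
converge are homeomorphic over the space. -/
theorem exists_homeomorph_of_isDenseInducing [T3Space Y] [T3Space Z] {i : X → Y} {j : X → Z}
    (hi : IsDenseInducing i) (hj : IsDenseInducing j)
    (hij : ∀ y, ∃ z, Tendsto j (comap i (𝓝 y)) (𝓝 z))
    (hji : ∀ z, ∃ y, Tendsto i (comap j (𝓝 z)) (𝓝 y)) :
    ∃ h : Y ≃ₜ Z, ∀ x, h (i x) = j x := by
  have hc := hi.continuous_extend hij
  have hc' := hj.continuous_extend hji
  have h₁ : ∀ x, hi.extend j (i x) = j x := hi.extend_eq hj.continuous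
  have h₂ : ∀ x, hj.extend i (j x) = i x := hj.extend_eq hi.continuous
  refine ⟨⟨⟨hi.extend j, hj.extend i, fun y => ?_, fun z => ?_⟩, hc, hc'⟩, h₁⟩
  · exact congrFun (hi.dense.equalizer (hc'.comp hc) continuous_id
      (funext fun x => by simp [h₁, h₂])) y
  · exact congrFun (hj.dense.equalizer (hc.comp hc') continuous_id
      (funext fun x => by simp [h₁, h₂])) z

theorem isDenseInducing_codRestrict {e : X → Y} (he : IsInducing e) {A : Set Y}
    (hA : ∀ x, e x ∈ A) (hd : A ⊆ closure (range e)) :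
    IsDenseInducing (A.codRestrict e hA) where
  toIsInducing := he.codRestrict hA
  dense y := by
    rw [IsInducing.subtypeVal.closure_eq_preimage_closure_image, ← range_comp]
    exact hd y.2

theorem isInducing_evalMap (X : Type u) [TopologicalSpace X] [CompletelyRegularSpace X] :
    IsInducing (evalMap X) := by
  refine isInducing_iff_nhds.2 fun x => le_antisymm ?_ fun V hV => ?_
  · have : Continuous (evalMap X) := continuous_pi fun f => f.continuous
    exact (this.tendsto x).le_comap
  · obtain ⟨f, hf, hfx, hfV⟩ := CompletelyRegularSpace.completely_regular_isOpen x
      (interior V) isOpen_interior (mem_interior_iff_mem_nhds.2 hV)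
    have ht := tendsto_evalFilter (evalMap X x) ⟨fun y => (f y : ℝ), by fun_prop⟩
    refine mem_of_superset (ht.eventually (gt_mem_nhds (?_ : _ < (1 : ℝ)))) fun y hy => ?_
    · simp [evalMap, hfx]
    · by_contra hyV
      have h1 := hfV fun h => hyV (interior_subset h)
      simp [h1] at hy

theorem isDenseInducing_toRealcompactification (X : Type u) [TopologicalSpace X]
    [CompletelyRegularSpace X] : IsDenseInducing (toRealcompactification X) :=
  isDenseInducing_codRestrict (isInducing_evalMap X) _ subset_rfl

theorem comap_toRealcompactification_nhds (y : Realcompactification X) :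
    comap (toRealcompactification X) (𝓝 y) = evalFilter y.1 :=
  comap_codRestrict_nhds _ y

theorem exists_tendsto_toRealcompactification {F : Filter X} [F.NeBot]
    (hF : ∀ f : X → ℝ, Continuous f → ∃ c, Tendsto f F (𝓝 c)) :
    ∃ y, Tendsto (toRealcompactification X) F (𝓝 y) := by
  choose p hp using fun f : C(X, ℝ) => hF f f.continuous
  have ht : Tendsto (evalMap X) F (𝓝 p) := tendsto_pi_nhds.2 hp
  exact ⟨⟨p, mem_closure_of_tendsto ht (Eventually.of_forall mem_range_self)⟩,
    tendsto_subtype_rng.2 ht⟩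

end DenseInducing

/-! ### Cauchy filters and completions -/

section Completion

theorem exists_tendsto_completion_coe {X : Type u} [UniformSpace X] {F : Filter X} (hF : Cauchy F) :
    ∃ z : UniformSpace.Completion X, Tendsto ((↑) : X → UniformSpace.Completion X) F (𝓝 z) :=
  CompleteSpace.complete (hF.map (UniformSpace.Completion.uniformContinuous_coe X))

theorem cauchy_comap_completion_coe {X : Type u} [UniformSpace X] (z : UniformSpace.Completion X) :
    Cauchy (comap ((↑) : X → UniformSpace.Completion X) (𝓝 z)) := by
  have := UniformSpace.Completion.isDenseInducing_coe.comap_nhds_neBot z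
  exact cauchy_nhds.comap (UniformSpace.Completion.comap_coe_eq_uniformity X).le

variable {X : Type u} [t : TopologicalSpace X]

theorem isDenseInducing_completion_coe (v : UniformSpace X) (h : v.toTopologicalSpace = t) :
    IsDenseInducing (@UniformSpace.Completion.coe' X v) := by
  subst h
  exact UniformSpace.Completion.isDenseInducing_coe

instance (X : Type u) [TopologicalSpace X] : T0Space (DieudonneCompletion X) :=
  @UniformSpace.Completion.t0Space X (fineUniformSpace X)

theorem uniformContinuous_fine [CompletelyRegularSpace X] {f : X → ℝ} (hf : Continuous f) :
    @UniformContinuous X ℝ (fineUniformSpace X) _ f := by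
  -- Refining the fine uniformity by the pullback along `f` does not change the topology, so it
  -- gives nothing finer.
  have hle : fineUniformSpace X ≤ fineUniformSpace X ⊓ UniformSpace.comap f inferInstance := by
    refine sInf_le ?_
    rw [mem_ofPred_eq, UniformSpace.toTopologicalSpace_inf, fineUniformSpace_toTopologicalSpace]
    exact inf_eq_left.2 hf.le_induced
  exact uniformContinuous_iff_le_comap.2 (hle.trans inf_le_right)

theorem exists_tendsto_of_cauchy_fine [CompletelyRegularSpace X] {F : Filter X}
    (hF : Cauchy (uniformSpace := fineUniformSpace X) F) {f : X → ℝ} (hf : Continuous f) :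
    ∃ c, Tendsto f F (𝓝 c) :=
  CompleteSpace.complete (@Cauchy.map X ℝ (fineUniformSpace X) _ F f hF (uniformContinuous_fine hf))

end Completion

/-! ### Identification of `μG`, `ϱ_ωG` and `υG`, and extension of the operations -/

section Group

variable {G : Type u} [Group G] [TopologicalSpace G] [IsTopologicalGroup G]

instance (G : Type u) [Group G] [TopologicalSpace G] [IsTopologicalGroup G] :
    T0Space (RaikovCompletion G) :=
  @UniformSpace.Completion.t0Space G (twoSidedUniformSpace G)

theorem isDenseInducing_toRaikov (G : Type u) [Group G] [TopologicalSpace G]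
    [IsTopologicalGroup G] : IsDenseInducing (toRaikov G) :=
  isDenseInducing_completion_coe _ (twoSidedUniformSpace_toTopologicalSpace G)

theorem isDenseInducing_toRaikovOmega (G : Type u) [Group G] [TopologicalSpace G]
    [IsTopologicalGroup G] : IsDenseInducing (toRaikovOmega G) :=
  isDenseInducing_codRestrict (isDenseInducing_toRaikov G).isInducing _ fun y _ =>
    (isDenseInducing_toRaikov G).dense y

theorem IsOmegaCauchy.exists_tendsto_toRaikovOmega {F : Filter G} (hF : IsOmegaCauchy F) :
    ∃ z, Tendsto (toRaikovOmega G) F (𝓝 z) := by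
  obtain ⟨z, hz⟩ : ∃ z, Tendsto (toRaikov G) F (𝓝 z) :=
    @exists_tendsto_completion_coe G (twoSidedUniformSpace G) F hF.cauchy
  refine ⟨⟨z, fun s hs hzs => ?_⟩, tendsto_subtype_rng.2 hz⟩
  obtain ⟨O, hO, rfl⟩ := isGδ_iff_eq_iInter_nat.1 hs
  obtain ⟨x, hx⟩ := hF.countablyMeets (fun n => toRaikov G ⁻¹' O n) fun n =>
    hz ((hO n).mem_nhds (mem_iInter.1 hzs n))
  exact ⟨toRaikov G x, mem_iInter.2 hx, mem_range_self x⟩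

theorem isOmegaCauchy_comap_toRaikovOmega (y : RaikovOmega G) :
    IsOmegaCauchy (comap (toRaikovOmega G) (𝓝 y)) := by
  have h : comap (toRaikovOmega G) (𝓝 y) = comap (toRaikov G) (𝓝 y.1) :=
    comap_codRestrict_nhds _ y
  rw [h]
  refine .of_cauchy (@cauchy_comap_completion_coe G (twoSidedUniformSpace G) y.1) fun S hS => ?_
  choose W hW hWS using fun n => mem_comap.1 (hS n)
  obtain ⟨_, hx, x, rfl⟩ := y.2 (⋂ n, interior (W n)) (.iInter_of_isOpen fun _ => isOpen_interior)
    (mem_iInter.2 fun n => mem_interior_iff_mem_nhds.2 (hW n))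
  exact ⟨x, fun n => hWS n (interior_subset (s := W n) (mem_iInter.1 hx n))⟩

theorem exists_continuous_mul_raikovOmega (G : Type u) [Group G] [TopologicalSpace G]
    [IsTopologicalGroup G] :
    ∃ m : RaikovOmega G × RaikovOmega G → RaikovOmega G, Continuous m ∧
      ∀ x y : G, m (toRaikovOmega G x, toRaikovOmega G y) = toRaikovOmega G (x * y) := by
  have hd := isDenseInducing_toRaikovOmega G
  have hd₂ := hd.prodMap hd
  refine ⟨hd₂.extend fun x => toRaikovOmega G (x.1 * x.2), hd₂.continuous_extend fun b => ?_,
    fun x y => hd₂.extend_eq (hd.continuous.comp continuous_mul) (x, y)⟩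
  obtain ⟨z, hz⟩ := ((isOmegaCauchy_comap_toRaikovOmega b.1).mul
    (isOmegaCauchy_comap_toRaikovOmega b.2)).exists_tendsto_toRaikovOmega
  refine ⟨z, ?_⟩
  rw [tendsto_map'_iff, prod_comap_comap_eq, ← nhds_prod_eq] at hz
  exact hz

theorem exists_continuous_inv_raikovOmega (G : Type u) [Group G] [TopologicalSpace G]
    [IsTopologicalGroup G] :
    ∃ j : RaikovOmega G → RaikovOmega G, Continuous j ∧
      ∀ x : G, j (toRaikovOmega G x) = toRaikovOmega G x⁻¹ := by
  have hd := isDenseInducing_toRaikovOmega G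
  refine ⟨hd.extend fun x => toRaikovOmega G x⁻¹, hd.continuous_extend fun b => ?_,
    fun x => hd.extend_eq (hd.continuous.comp continuous_inv) x⟩
  obtain ⟨z, hz⟩ := (isOmegaCauchy_comap_toRaikovOmega b).inv.exists_tendsto_toRaikovOmega
  exact ⟨z, tendsto_map'_iff.1 hz⟩

theorem IsSimplySMFactorizable.exists_homeomorph_raikovOmega (hG : IsSimplySMFactorizable G) :
    ∃ k : RaikovOmega G ≃ₜ Realcompactification G,
      ∀ x : G, k (toRaikovOmega G x) = toRealcompactification G x := by
  have := completelyRegularSpace_of_isTopologicalGroup G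
  refine exists_homeomorph_of_isDenseInducing (isDenseInducing_toRaikovOmega G)
    (isDenseInducing_toRealcompactification G) (fun y => ?_) fun z => ?_
  · have hy := isOmegaCauchy_comap_toRaikovOmega y
    have := hy.countablyMeets.neBot
    exact exists_tendsto_toRealcompactification fun f hf => hy.exists_tendsto hG hf
  · rw [comap_toRealcompactification_nhds]
    exact (hG.isOmegaCauchy_evalFilter z.2).exists_tendsto_toRaikovOmega

theorem IsSimplySMFactorizable.exists_homeomorph_dieudonneCompletion
    (hG : IsSimplySMFactorizable G) :
    ∃ k : DieudonneCompletion G ≃ₜ Realcompactification G,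
      ∀ x : G, k (toDieudonne G x) = toRealcompactification G x := by
  have := completelyRegularSpace_of_isTopologicalGroup G
  refine exists_homeomorph_of_isDenseInducing (i := toDieudonne G)
    (isDenseInducing_completion_coe _ (fineUniformSpace_toTopologicalSpace G))
    (isDenseInducing_toRealcompactification G) (fun y => ?_) fun z => ?_
  · have hy : Cauchy (uniformSpace := fineUniformSpace G) (comap (toDieudonne G) (𝓝 y)) :=
      @cauchy_comap_completion_coe G (fineUniformSpace G) y
    have := hy.1
    exact exists_tendsto_toRealcompactification fun f hf => exists_tendsto_of_cauchy_fine hy hf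
  · rw [comap_toRealcompactification_nhds]
    exact @exists_tendsto_completion_coe G (fineUniformSpace G) _ (hG.cauchy_fine_evalFilter z.2)

theorem IsSimplySMFactorizable.isCompletionFriendly [T2Space G] (hG : IsSimplySMFactorizable G) :
    IsCompletionFriendly G := by
  have hd := isDenseInducing_toRaikovOmega G
  exact ⟨hd.isInducing.isEmbedding, fun f hf => ⟨hd.extend f, hd.continuous_extend fun b =>
    (isOmegaCauchy_comap_toRaikovOmega b).exists_tendsto hG hf, hd.extend_eq hf⟩⟩

theorem isPTGroup_of_homeomorph {h : DieudonneCompletion G ≃ₜ RaikovOmega G}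
    (hh : ∀ x : G, h (toDieudonne G x) = toRaikovOmega G x) : IsPTGroup G := by
  obtain ⟨m, hm, hmx⟩ := exists_continuous_mul_raikovOmega G
  obtain ⟨j, hj, hjx⟩ := exists_continuous_inv_raikovOmega G
  refine ⟨⟨fun z => h.symm (m (h z.1, h z.2)), by fun_prop, fun x y => ?_⟩,
    fun z => h.symm (j (h z)), by fun_prop, fun x => ?_⟩
  · simp only [hh, hmx]
    rw [← hh, h.symm_apply_apply]
  · simp only [hh, hjx]
    rw [← hh, h.symm_apply_apply]

end Group

end SMFactor

theorem theorem3p2 {G : Type*} [Group G] [TopologicalSpace G] [IsTopologicalGroup G] [T2Space G]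
    (hG : SMFactor.IsSimplySMFactorizable G) :
    (∃ h : SMFactor.DieudonneCompletion G ≃ₜ SMFactor.RaikovOmega G,
      ∀ x : G, h (SMFactor.toDieudonne G x) = SMFactor.toRaikovOmega G x) ∧
    (∃ k : SMFactor.RaikovOmega G ≃ₜ SMFactor.Realcompactification G,
      ∀ x : G, k (SMFactor.toRaikovOmega G x) = SMFactor.toRealcompactification G x) ∧
    SMFactor.IsCompletionFriendly G ∧
    SMFactor.IsPTGroup G := by
  obtain ⟨k, hk⟩ := hG.exists_homeomorph_raikovOmega
  obtain ⟨l, hl⟩ := hG.exists_homeomorph_dieudonneCompletion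
  have hlk : ∀ x : G, (l.trans k.symm) (SMFactor.toDieudonne G x) = SMFactor.toRaikovOmega G x :=
    fun x => by rw [Homeomorph.trans_apply, hl, ← hk, k.symm_apply_apply]
  exact ⟨⟨l.trans k.symm, hlk⟩, ⟨k, hk⟩, hG.isCompletionFriendly,
    SMFactor.isPTGroup_of_homeomorph hlk⟩
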